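/- Let $\rho_s,\sigma>0$ and $\bar\gamma=\rho_s/\sigma^2$. Let $\mathbf{G},\mathbf{H}\in\mathbb{C}^{2\times 2}$ be random matrices whose eight entries are jointly independent and each distributed as $\mathcal{CN}(0,1)$ (independent real and imaginary parts, each $\mathcal{N}(0,1/2)$). Almost surely let $\mathbf{G}=\mathbf{U}\sqrt{\boldsymbol{\Lambda}}\,\mathbf{V}^\dagger$ and $\mathbf{H}=\mathbf{W}\sqrt{\boldsymbol{\Omega}}\,\mathbf{Q}^\dagger$ be singular value decompositions, with $\mathbf{U},\mathbf{V},\mathbf{W},\mathbf{Q}$ unitary with columns $\mathbf{u}_j,\mathbf{v}_j,\mathbf{w}_i,\mathbf{q}_i$, $\boldsymbol{\Lambda}=\mathrm{diag}(\lambda_1,\lambda_2)$, $\lambda_1\ge\lambda_2\ge 0$, and $\boldsymbol{\Omega}=\mathrm{diag}(\omega_1,\omega_2)$, $\omega_1\ge\omega_2\ge 0$; write $\mathbf{v}_j=(v_{j1}\;v_{j2})^T$ and $\mathbf{w}_i=(w_{i1}\;w_{i2})^T$. For $i,j\in\{1,2\}$ let $$\boldsymbol{\Phi}_{j,\mathrm{cmp}}^{(i)}=\mathrm{diag}\left(e^{-\sqrt{-1}\,\arg(v_{j1}^*w_{i1})},\;e^{-\sqrt{-1}\,\arg(v_{j2}^*w_{i2})}\right)$$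 and let $$\gamma_{j,\mathrm{cmp}}^{(i)}=\bar\gamma\left|\mathbf{u}_j^\dagger\,\mathbf{G}\,\boldsymbol{\Phi}_{j,\mathrm{cmp}}^{(i)}\,\mathbf{H}\,\mathbf{q}_i\right|^2$$ be the phase-compensated instantaneous SNR for the transmission direction $\mathbf{q}_i$ and the combining vector $\mathbf{u}_j$. Then, for all $i,j\in\{1,2\}$, almost surely $$\gamma_{j,\mathrm{cmp}}^{(i)}=\bar\gamma\,\lambda_j\,\omega_i\left(|v_{j1}||w_{i1}|+|v_{j2}||w_{i2}|\right)^2,$$ each $\gamma_{j,\mathrm{cmp}}^{(i)}$ is integrable, and $$\mathbb{E}\left\{\gamma_{1,\mathrm{cmp}}^{(1)}\right\}>\mathbb{E}\left\{\gamma_{2,\mathrm{cmp}}^{(1)}\right\}=\mathbb{E}\left\{\gamma_{1,\mathrm{cmp}}^{(2)}\right\}>\mathbb{E}\left\{\gamma_{2,\mathrm{cmp}}^{(2)}\right\}.$$ -/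

import Mathlib

open MeasureTheory ProbabilityTheory

/-- The standard circularly symmetric complex Gaussian law `CN(0,1)` on `ℂ`: real and imaginary
parts are independent, each with law `N(0, 1/2)`. -/
noncomputable def stdComplexGaussian : Measure ℂ :=
  ((gaussianReal 0 (1 / 2)).prod (gaussianReal 0 (1 / 2))).map
    (fun p : ℝ × ℝ => (⟨p.1, p.2⟩ : ℂ))

/-- Rayleigh fading: all eight entries of the random channel matrices `G` (RIS to receiver, index
`Sum.inl`) and `H` (transmitter to RIS, index `Sum.inr`) are jointly independent, each with law
`CN(0,1)`. -/
structure IsRayleighFading {Ω : Type*} [MeasurableSpace Ω] (P : Measure Ω)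
    (G H : Ω → Matrix (Fin 2) (Fin 2) ℂ) : Prop where
  law_G : ∀ r c, HasLaw (fun x => G x r c) stdComplexGaussian P
  law_H : ∀ r c, HasLaw (fun x => H x r c) stdComplexGaussian P
  indep : iIndepFun
    (Sum.elim (fun (rc : Fin 2 × Fin 2) (x : Ω) => G x rc.1 rc.2)
      (fun (rc : Fin 2 × Fin 2) (x : Ω) => H x rc.1 rc.2)) P

/-- `A = L √Λ R†` is a singular value decomposition of `A` with squared singular values
`s 0 ≥ s 1 ≥ 0` (the ordered eigenvalues of `A† A`). -/
structure IsSVD (A L : Matrix (Fin 2) (Fin 2) ℂ) (s : Fin 2 → ℝ)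
    (R : Matrix (Fin 2) (Fin 2) ℂ) : Prop where
  left_unitary : L ∈ Matrix.unitaryGroup (Fin 2) ℂ
  right_unitary : R ∈ Matrix.unitaryGroup (Fin 2) ℂ
  nonneg : 0 ≤ s 1
  ordered : s 1 ≤ s 0
  eq_mul : A = L * Matrix.diagonal (fun k => ((Real.sqrt (s k) : ℝ) : ℂ)) * R.conjTranspose

/-- The RIS reflection matrix `diag (exp (i φ₁), exp (i φ₂))`. -/
noncomputable def risMatrix (φ : Fin 2 → ℝ) : Matrix (Fin 2) (Fin 2) ℂ :=
  Matrix.diagonal fun k => Complex.exp (Complex.I * (φ k : ℂ))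

/-- Instantaneous SNR `(ρ / σ²) |b† G Φ H a|²` at the receiver, for transmit power `ρ`, noise
variance `σ²`, transmission direction `a` and combining vector `b`. -/
noncomputable def snr (ρ σ : ℝ) (G Φ H : Matrix (Fin 2) (Fin 2) ℂ) (a b : Fin 2 → ℂ) : ℝ :=
  ρ / σ ^ 2 * ‖dotProduct (star b) ((G * Φ * H).mulVec a)‖ ^ 2

/-- The compensating phases `φ_k = - arg (v_{jk}^* w_{ik})`, where `v_j` is the `j`-th column of
`V` and `w_i` is the `i`-th column of `W`. -/
noncomputable def cmpPhase (V W : Matrix (Fin 2) (Fin 2) ℂ) (j i : Fin 2) (k : Fin 2) : ℝ :=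
  -Complex.arg (star (V k j) * W k i)

/-- The phase-compensated SNR: the transmission direction is the right singular vector `q_i` of
`H = W √Ω Q†`, the combining vector is the left singular vector `u_j` of `G = U √Λ V†`, and the
RIS uses the compensating phases. -/
noncomputable def snrCmp (ρ σ : ℝ) (G H U V W Q : Matrix (Fin 2) (Fin 2) ℂ) (j i : Fin 2) : ℝ :=
  snr ρ σ G (risMatrix (cmpPhase V W j i)) H (fun k => Q k i) (fun k => U k j)

/-!
The phases of the reflection matrix align the two summands of `v_j† Φ w_i`, so
`u_j† G Φ H q_i = √λ_j √ω_i (|v_{j1}| |w_{i1}| + |v_{j2}| |w_{i2}|)` and the closed form of the SNR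
holds for every pair of singular value decompositions (`snrCmp_eq`).

The right-hand side does not depend on which decompositions are chosen. If the off-diagonal entry of
`A† A` (`crossTerm A`) is nonzero, then the squared singular values of `A` are distinct, and they and
the moduli of the entries of the right singular vectors are explicit functions of the two column
norms and of `|det A|`. Hence, with `A = G` and `B = Hᵀ`, the SNR is almost surely `ρ / σ²` times the
measurable function `gain A B j i` of the channel coefficients (`snrCmp_eq_gain`), although the
decompositions themselves need not depend measurably on them. It is integrable because it is at most
a constant times the product of the squared Frobenius norms of `G` and `H`, which are independent.

The expectations are compared through two permutations of the eight i.i.d. coefficients, which leave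
their joint law unchanged.
* Exchanging `G` with `Hᵀ` turns `gain A B j i` into `gain A B i j`, whence the equality in the middle
  (`integral_gain_comm`).
* Exchanging the columns of `G` keeps the singular values and interchanges the two coordinates of the
  right singular vectors. In dimension two the moduli of the coordinates of `v_2` are those of `v_1`
  in opposite order, so after this exchange `gain A B 1 i` has the same overlap factor as
  `gain A B 0 i`, with `λ_2` in place of `λ_1` (`gain_one_swap_lt`). Almost surely `λ_2 < λ_1` and the
  other factors are positive, which gives both strict inequalities (`integral_gain_one_lt`).

Up to the event that `G` or `Hᵀ` has top left entry zero, each exceptional event is described by an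
equation that can be solved for one coefficient in terms of the others; such events are null by Fubini because the law of each coefficient has no
atoms (`channelLaw_ae_ne`).
-/

namespace RISChannel

/-! ### The phase-compensated SNR in terms of the singular value decompositions -/

lemma mul_exp_neg_arg (z : ℂ) :
    z * Complex.exp (Complex.I * ((-Complex.arg z : ℝ) : ℂ)) = (‖z‖ : ℂ) := by
  conv_lhs => rw [← Complex.norm_mul_exp_arg_mul_I z]
  rw [mul_assoc, Complex.norm_mul_exp_arg_mul_I, ← Complex.exp_add]
  simp [mul_comm]

/-- The reflection phases align the two terms of `v_j† Φ w_i`, so that no cancellation is left. -/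
lemma conjTranspose_mul_risMatrix_mul (V W : Matrix (Fin 2) (Fin 2) ℂ) (j i : Fin 2) :
    (V.conjTranspose * risMatrix (cmpPhase V W j i) * W) j i =
      ((‖V 0 j‖ * ‖W 0 i‖ + ‖V 1 j‖ * ‖W 1 i‖ : ℝ) : ℂ) := by
  have key : ∀ k, star (V k j) * Complex.exp (Complex.I * (cmpPhase V W j i k : ℂ)) * W k i =
      ((‖V k j‖ * ‖W k i‖ : ℝ) : ℂ) := by
    intro k
    have h := mul_exp_neg_arg (star (V k j) * W k i)
    rw [norm_mul, norm_star] at h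
    rw [← h, cmpPhase]
    ring
  rw [Matrix.mul_apply, Fin.sum_univ_two, risMatrix, Matrix.mul_diagonal, Matrix.mul_diagonal,
    Matrix.conjTranspose_apply, Matrix.conjTranspose_apply, key, key]
  push_cast
  ring

lemma star_dotProduct_mulVec (M U Q : Matrix (Fin 2) (Fin 2) ℂ) (j i : Fin 2) :
    dotProduct (star fun k => U k j) (M.mulVec fun k => Q k i) =
      (U.conjTranspose * M * Q) j i := by
  rw [Matrix.mul_assoc]
  simp [Matrix.mul_apply, dotProduct, Matrix.mulVec]

theorem snrCmp_eq (ρ σ : ℝ) {G H U V W Q : Matrix (Fin 2) (Fin 2) ℂ} {s t : Fin 2 → ℝ}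
    (hG : IsSVD G U s V) (hH : IsSVD H W t Q) (j i : Fin 2) :
    snrCmp ρ σ G H U V W Q j i =
      ρ / σ ^ 2 * s j * t i * (‖V 0 j‖ * ‖W 0 i‖ + ‖V 1 j‖ * ‖W 1 i‖) ^ 2 := by
  have hs : ∀ j, 0 ≤ s j := fun j => by
    fin_cases j
    exacts [hG.nonneg.trans hG.ordered, hG.nonneg]
  have ht : ∀ j, 0 ≤ t j := fun j => by
    fin_cases j
    exacts [hH.nonneg.trans hH.ordered, hH.nonneg]
  have hU : U.conjTranspose * U = 1 := Matrix.mem_unitaryGroup_iff'.1 hG.left_unitary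
  have hQ : Q.conjTranspose * Q = 1 := Matrix.mem_unitaryGroup_iff'.1 hH.right_unitary
  set Φ := risMatrix (cmpPhase V W j i) with hΦ
  set D := Matrix.diagonal (fun k => ((Real.sqrt (s k) : ℝ) : ℂ)) with hD
  set E := Matrix.diagonal (fun k => ((Real.sqrt (t k) : ℝ) : ℂ)) with hE
  have hprod : U.conjTranspose * (G * Φ * H) * Q = D * (V.conjTranspose * Φ * W) * E := by
    rw [hG.eq_mul, hH.eq_mul]
    calc _ = (U.conjTranspose * U) * D * (V.conjTranspose * Φ * W) * E *
          (Q.conjTranspose * Q) := by simp only [Matrix.mul_assoc, hD, hE]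
      _ = _ := by rw [hU, hQ, Matrix.one_mul, Matrix.mul_one]
  rw [snrCmp, snr, star_dotProduct_mulVec, ← hΦ, hprod, hE, Matrix.mul_diagonal, hD,
    Matrix.diagonal_mul, conjTranspose_mul_risMatrix_mul, norm_mul, norm_mul, Complex.norm_real,
    Complex.norm_real, Complex.norm_real, Real.norm_eq_abs, Real.norm_eq_abs, Real.norm_eq_abs,
    mul_pow, mul_pow, sq_abs, sq_abs, sq_abs, Real.sq_sqrt (hs j), Real.sq_sqrt (ht i)]
  ring

/-! ### Squared singular values and moduli of right singular vectors -/

/-- The squared norm of the `k`-th column of `A`, that is the `k`-th diagonal entry of `A† A`. -/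
noncomputable def colSq (A : Matrix (Fin 2) (Fin 2) ℂ) (k : Fin 2) : ℝ :=
  ‖A 0 k‖ ^ 2 + ‖A 1 k‖ ^ 2

/-- The off-diagonal entry of `A† A`. -/
noncomputable def crossTerm (A : Matrix (Fin 2) (Fin 2) ℂ) : ℂ :=
  star (A 0 0) * A 0 1 + star (A 1 0) * A 1 1

/-- The difference of the two eigenvalues of `A† A`, computed from its trace and determinant. -/
noncomputable def gap (A : Matrix (Fin 2) (Fin 2) ℂ) : ℝ :=
  Real.sqrt ((colSq A 0 + colSq A 1) ^ 2 - 4 * ‖A.det‖ ^ 2)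

/-- The eigenvalues of `A† A` (the squared singular values of `A`), the larger one first. -/
noncomputable def eig (A : Matrix (Fin 2) (Fin 2) ℂ) : Fin 2 → ℝ :=
  ![(colSq A 0 + colSq A 1 + gap A) / 2, (colSq A 0 + colSq A 1 - gap A) / 2]

/-- The squared modulus of the `k`-th coordinate of the `j`-th unit eigenvector of `A† A`. It is
meaningful when the two eigenvalues differ, and it is `0` when they coincide. -/
noncomputable def weight (A : Matrix (Fin 2) (Fin 2) ℂ) (k : Fin 2) : Fin 2 → ℝ :=
  ![(colSq A k - eig A 1) / gap A, (eig A 0 - colSq A k) / gap A]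

lemma colSq_nonneg (A : Matrix (Fin 2) (Fin 2) ℂ) (k : Fin 2) : 0 ≤ colSq A k := by
  unfold colSq; positivity

/-- Lagrange's identity. -/
lemma colSq_mul_colSq (A : Matrix (Fin 2) (Fin 2) ℂ) :
    colSq A 0 * colSq A 1 = ‖A.det‖ ^ 2 + ‖crossTerm A‖ ^ 2 := by
  simp only [colSq, crossTerm, Matrix.det_fin_two, ← Complex.normSq_eq_norm_sq,
    Complex.normSq_apply, Complex.star_def, Complex.add_re, Complex.add_im, Complex.sub_re,
    Complex.sub_im, Complex.mul_re, Complex.mul_im, Complex.conj_re, Complex.conj_im]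
  ring

lemma discr_eq (A : Matrix (Fin 2) (Fin 2) ℂ) :
    (colSq A 0 + colSq A 1) ^ 2 - 4 * ‖A.det‖ ^ 2 =
      (colSq A 0 - colSq A 1) ^ 2 + 4 * ‖crossTerm A‖ ^ 2 := by
  linear_combination 4 * colSq_mul_colSq A

lemma gap_nonneg (A : Matrix (Fin 2) (Fin 2) ℂ) : 0 ≤ gap A := Real.sqrt_nonneg _

lemma abs_colSq_sub_le_gap (A : Matrix (Fin 2) (Fin 2) ℂ) :
    |colSq A 0 - colSq A 1| ≤ gap A := by
  rw [gap, discr_eq]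
  exact Real.abs_le_sqrt (le_add_of_nonneg_right (by positivity))

lemma abs_colSq_sub_lt_gap {A : Matrix (Fin 2) (Fin 2) ℂ} (h : crossTerm A ≠ 0) :
    |colSq A 0 - colSq A 1| < gap A := by
  have : 0 < ‖crossTerm A‖ := norm_pos_iff.2 h
  rw [gap, discr_eq]
  exact Real.lt_sqrt_of_sq_lt (by rw [sq_abs]; exact lt_add_of_pos_right _ (by positivity))

lemma gap_le (A : Matrix (Fin 2) (Fin 2) ℂ) : gap A ≤ colSq A 0 + colSq A 1 := by
  have h0 := colSq_nonneg A 0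
  have h1 := colSq_nonneg A 1
  exact Real.sqrt_le_iff.2 ⟨by positivity, sub_le_self _ (by positivity)⟩

lemma gap_lt {A : Matrix (Fin 2) (Fin 2) ℂ} (h : A.det ≠ 0) :
    gap A < colSq A 0 + colSq A 1 := by
  have hd : 0 < ‖A.det‖ := norm_pos_iff.2 h
  have h0 := colSq_nonneg A 0
  have h1 := colSq_nonneg A 1
  have : 0 < ‖A.det‖ ^ 2 + ‖crossTerm A‖ ^ 2 := by positivity
  rw [← colSq_mul_colSq] at this
  have h0' : 0 < colSq A 0 := pos_of_mul_pos_left this h1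
  exact (Real.sqrt_lt' (by positivity)).2 (sub_lt_self _ (by positivity))

lemma gap_pos {A : Matrix (Fin 2) (Fin 2) ℂ} (h : crossTerm A ≠ 0) : 0 < gap A :=
  (abs_nonneg _).trans_lt (abs_colSq_sub_lt_gap h)

lemma eig_nonneg (A : Matrix (Fin 2) (Fin 2) ℂ) (j : Fin 2) : 0 ≤ eig A j := by
  have := gap_le A
  have := gap_nonneg A
  fin_cases j <;> simp [eig] <;> linarith

lemma eig_le (A : Matrix (Fin 2) (Fin 2) ℂ) (j : Fin 2) :
    eig A j ≤ colSq A 0 + colSq A 1 := by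
  have := gap_le A
  have := gap_nonneg A
  fin_cases j <;> simp [eig] <;> linarith

lemma eig_pos {A : Matrix (Fin 2) (Fin 2) ℂ} (h : A.det ≠ 0) (j : Fin 2) : 0 < eig A j := by
  have := gap_lt h
  have := gap_nonneg A
  fin_cases j <;> simp [eig] <;> linarith

lemma eig_one_lt_eig_zero {A : Matrix (Fin 2) (Fin 2) ℂ} (h : crossTerm A ≠ 0) :
    eig A 1 < eig A 0 := by
  have := gap_pos h
  simp [eig]
  linarith

lemma weight_pos {A : Matrix (Fin 2) (Fin 2) ℂ} (hA : crossTerm A ≠ 0) (k j : Fin 2) :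
    0 < weight A k j := by
  have h := abs_lt.1 (abs_colSq_sub_lt_gap hA)
  fin_cases k <;> fin_cases j <;> simp only [weight, eig] <;>
    exact div_pos (by simp; linarith) (gap_pos hA)

lemma weight_le_one (A : Matrix (Fin 2) (Fin 2) ℂ) (k j : Fin 2) : weight A k j ≤ 1 := by
  have h := abs_le.1 (abs_colSq_sub_le_gap A)
  fin_cases k <;> fin_cases j <;> simp only [weight, eig] <;>
    exact div_le_one_of_le₀ (by simp; linarith) (gap_nonneg A)

/-- The second eigenvector has the coordinate moduli of the first one, in the opposite order. -/
lemma weight_one (A : Matrix (Fin 2) (Fin 2) ℂ) (k : Fin 2) :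
    weight A k 1 = weight A (Fin.rev k) 0 := by
  fin_cases k <;> simp [weight, eig] <;> ring

/-- A singular value decomposition determines the ordered squared singular values and, when these
are distinct, also the moduli of the entries of the right factor: the diagonal of
`A† A = R diag(s) R†` and the unit rows of `R` give linear equations for the squared moduli. -/
theorem eig_and_weight_of_isSVD {A L R : Matrix (Fin 2) (Fin 2) ℂ} {s : Fin 2 → ℝ}
    (h : IsSVD A L s R) :
    s = eig A ∧ (crossTerm A ≠ 0 → ∀ k j, ‖R k j‖ ^ 2 = weight A k j) := by
  have hs0 : 0 ≤ s 0 := h.nonneg.trans h.ordered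
  have hL : L.conjTranspose * L = 1 := Matrix.mem_unitaryGroup_iff'.1 h.left_unitary
  have hR : R.conjTranspose * R = 1 := Matrix.mem_unitaryGroup_iff'.1 h.right_unitary
  have hR' : R * R.conjTranspose = 1 := Matrix.mem_unitaryGroup_iff.1 h.right_unitary
  have hdet : ‖A.det‖ ^ 2 = s 0 * s 1 := by
    have hL1 : ‖L.det‖ = 1 := by
      have := congrArg (fun M => ‖Matrix.det M‖) hL
      simp only [Matrix.det_mul, Matrix.det_conjTranspose, norm_mul, norm_star, Matrix.det_one,
        norm_one] at this
      nlinarith [norm_nonneg L.det]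
    have hR1 : ‖R.det‖ = 1 := by
      have := congrArg (fun M => ‖Matrix.det M‖) hR
      simp only [Matrix.det_mul, Matrix.det_conjTranspose, norm_mul, norm_star, Matrix.det_one,
        norm_one] at this
      nlinarith [norm_nonneg R.det]
    rw [h.eq_mul, Matrix.det_mul, Matrix.det_mul, Matrix.det_conjTranspose, norm_mul, norm_mul,
      norm_star, hL1, hR1, Matrix.det_diagonal, Fin.prod_univ_two, norm_mul, Complex.norm_real,
      Complex.norm_real, Real.norm_eq_abs, Real.norm_eq_abs, one_mul, mul_one, mul_pow, sq_abs,
      sq_abs, Real.sq_sqrt hs0, Real.sq_sqrt h.nonneg]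
  have hAA : A.conjTranspose * A =
      R * Matrix.diagonal (fun k => ((s k : ℝ) : ℂ)) * R.conjTranspose := by
    set D := Matrix.diagonal (fun k => ((Real.sqrt (s k) : ℝ) : ℂ)) with hD
    have hDD : D.conjTranspose * D = Matrix.diagonal (fun k => ((s k : ℝ) : ℂ)) := by
      rw [hD, Matrix.diagonal_conjTranspose, Matrix.diagonal_mul_diagonal]
      congr 1
      funext k
      have hk : 0 ≤ s k := by
        fin_cases k
        exacts [hs0, h.nonneg]
      simp only [Pi.star_apply, Complex.star_def, Complex.conj_ofReal, ← Complex.ofReal_mul,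
        Real.mul_self_sqrt hk]
    rw [h.eq_mul, ← hD, ← hDD, Matrix.conjTranspose_mul, Matrix.conjTranspose_mul,
      Matrix.conjTranspose_conjTranspose]
    calc _ = R * D.conjTranspose * (L.conjTranspose * L) * D * R.conjTranspose := by
          simp only [Matrix.mul_assoc]
      _ = _ := by rw [hL, Matrix.mul_one]; simp only [Matrix.mul_assoc]
  have hstar : ∀ z : ℂ, star z * z = ((‖z‖ ^ 2 : ℝ) : ℂ) := fun z => by
    rw [Complex.star_def, Complex.conj_mul']; push_cast; rfl
  have hstar' : ∀ z : ℂ, z * star z = ((‖z‖ ^ 2 : ℝ) : ℂ) := fun z => by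
    rw [mul_comm, hstar]
  have hcol : ∀ k, colSq A k = s 0 * ‖R k 0‖ ^ 2 + s 1 * ‖R k 1‖ ^ 2 := by
    intro k
    have h1 := congrFun (congrFun hAA k) k
    rw [Matrix.mul_apply, Matrix.mul_apply, Fin.sum_univ_two, Fin.sum_univ_two,
      Matrix.mul_diagonal, Matrix.mul_diagonal] at h1
    simp only [Matrix.conjTranspose_apply, hstar, mul_right_comm _ _ (star _), hstar'] at h1
    norm_cast at h1
    rw [colSq, h1]
    ring
  have hrow : ∀ k, ‖R k 0‖ ^ 2 + ‖R k 1‖ ^ 2 = 1 := by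
    intro k
    have h1 := congrFun (congrFun hR' k) k
    simp only [Matrix.mul_apply, Fin.sum_univ_two, Matrix.conjTranspose_apply, hstar',
      Matrix.one_apply_eq] at h1
    exact_mod_cast h1
  have hcolR : ∀ k, ‖R 0 k‖ ^ 2 + ‖R 1 k‖ ^ 2 = 1 := by
    intro k
    have h1 := congrFun (congrFun hR k) k
    simp only [Matrix.mul_apply, Fin.sum_univ_two, Matrix.conjTranspose_apply, hstar,
      Matrix.one_apply_eq] at h1
    exact_mod_cast h1
  have htr : colSq A 0 + colSq A 1 = s 0 + s 1 := by
    rw [hcol, hcol]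
    linear_combination s 0 * hcolR 0 + s 1 * hcolR 1
  have hgap : gap A = s 0 - s 1 := by
    rw [gap, htr, hdet, ← Real.sqrt_sq (sub_nonneg.2 h.ordered)]
    congr 1
    ring
  have hseig : s = eig A := by
    funext j
    fin_cases j <;> simp [eig, htr, hgap]
  refine ⟨hseig, fun hA k j => ?_⟩
  have hg := (gap_pos hA).ne'
  fin_cases j
  · simp only [weight, ← hseig]
    refine (eq_div_iff hg).2 ?_
    simp only [Fin.zero_eta, hgap, hcol]
    linear_combination - s 1 * hrow k
  · simp only [weight, ← hseig]
    refine (eq_div_iff hg).2 ?_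
    simp only [Fin.mk_one, hgap, hcol]
    linear_combination s 0 * hrow k

/-- Transposing a singular value decomposition turns the left singular vectors into right ones, up
to a complex conjugation. -/
theorem isSVD_transpose {A L R : Matrix (Fin 2) (Fin 2) ℂ} {s : Fin 2 → ℝ}
    (h : IsSVD A L s R) : IsSVD A.transpose (R.map star) s (L.map star) := by
  have key : ∀ M ∈ Matrix.unitaryGroup (Fin 2) ℂ, M.map star ∈ Matrix.unitaryGroup (Fin 2) ℂ := by
    intro M hM
    rw [Matrix.mem_unitaryGroup_iff]
    have := congrArg Matrix.transpose (Matrix.mem_unitaryGroup_iff.1 hM)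
    rw [Matrix.transpose_mul, Matrix.transpose_one] at this
    convert this using 2 <;> ext a b <;> simp [Matrix.star_apply]
  refine ⟨key R h.right_unitary, key L h.left_unitary, h.nonneg, h.ordered, ?_⟩
  rw [h.eq_mul, Matrix.transpose_mul, Matrix.transpose_mul, Matrix.diagonal_transpose,
    Matrix.mul_assoc]
  congr 1
  congr 1
  ext a b
  simp

/-- The SNR of the stream pair `(j, i)` divided by `ρ / σ²`, as a function of `A = G` and
`B = Hᵀ` alone. -/
noncomputable def gain (A B : Matrix (Fin 2) (Fin 2) ℂ) (j i : Fin 2) : ℝ :=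
  eig A j * eig B i * (Real.sqrt (weight A 0 j) * Real.sqrt (weight B 0 i) +
    Real.sqrt (weight A 1 j) * Real.sqrt (weight B 1 i)) ^ 2

theorem snrCmp_eq_gain (ρ σ : ℝ) {G H U V W Q : Matrix (Fin 2) (Fin 2) ℂ} {s t : Fin 2 → ℝ}
    (hG : IsSVD G U s V) (hH : IsSVD H W t Q) (hG' : crossTerm G ≠ 0)
    (hH' : crossTerm H.transpose ≠ 0) (j i : Fin 2) :
    snrCmp ρ σ G H U V W Q j i = ρ / σ ^ 2 * gain G H.transpose j i := by
  obtain ⟨hs, hV⟩ := eig_and_weight_of_isSVD hG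
  obtain ⟨ht, hW⟩ := eig_and_weight_of_isSVD (isSVD_transpose hH)
  have hV' : ∀ k j, Real.sqrt (weight G k j) = ‖V k j‖ := fun k j => by
    rw [← hV hG', Real.sqrt_sq (norm_nonneg _)]
  have hW' : ∀ k j, Real.sqrt (weight H.transpose k j) = ‖W k j‖ := fun k j => by
    rw [← hW hH', Real.sqrt_sq (norm_nonneg _), Matrix.map_apply, norm_star]
  rw [snrCmp_eq ρ σ hG hH, gain, hV', hV', hW', hW', hs, ht]
  ring

lemma gain_comm (A B : Matrix (Fin 2) (Fin 2) ℂ) (j i : Fin 2) : gain A B j i = gain B A i j := by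
  unfold gain
  ring

lemma gain_nonneg (A B : Matrix (Fin 2) (Fin 2) ℂ) (j i : Fin 2) : 0 ≤ gain A B j i :=
  mul_nonneg (mul_nonneg (eig_nonneg A j) (eig_nonneg B i)) (sq_nonneg _)

lemma gain_le (A B : Matrix (Fin 2) (Fin 2) ℂ) (j i : Fin 2) :
    gain A B j i ≤ (colSq A 0 + colSq A 1) * (colSq B 0 + colSq B 1) * 2 ^ 2 := by
  have hw : ∀ C k l, Real.sqrt (weight C k l) ≤ 1 := fun C k l =>
    Real.sqrt_le_one.2 (weight_le_one C k l)
  have h := fun k => mul_le_one₀ (hw A k j) (Real.sqrt_nonneg _) (hw B k i)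
  have hA0 : 0 ≤ colSq A 0 + colSq A 1 := (eig_nonneg A j).trans (eig_le A j)
  have hB0 : 0 ≤ colSq B 0 + colSq B 1 := (eig_nonneg B i).trans (eig_le B i)
  exact mul_le_mul (mul_le_mul (eig_le A j) (eig_le B i) (eig_nonneg B i) hA0)
    (pow_le_pow_left₀ (by positivity) ((add_le_add (h 0) (h 1)).trans_eq one_add_one_eq_two) 2)
    (sq_nonneg _) (mul_nonneg hA0 hB0)

/-- Let `A'` be `A` with its columns exchanged. The weak right singular direction of `A'` has the
coordinate moduli of the strong one of `A`, so `gain A' B 1 i` and `gain A B 0 i` have the same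
overlap factor, and they differ only in the eigenvalue of `A† A` in front. -/
lemma gain_one_swap_lt {A A' B : Matrix (Fin 2) (Fin 2) ℂ} (hA' : ∀ r c, A' r c = A r (Fin.rev c))
    (hA : crossTerm A ≠ 0) (hB : crossTerm B ≠ 0) (hB' : B.det ≠ 0) (i : Fin 2) :
    gain A' B 1 i < gain A B 0 i := by
  have hc : ∀ k, colSq A' k = colSq A (Fin.rev k) := fun k => by simp [colSq, hA']
  have hc0 : colSq A' 0 = colSq A 1 := hc 0
  have hc1 : colSq A' 1 = colSq A 0 := hc 1
  have hd : ‖A'.det‖ = ‖A.det‖ := by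
    rw [← norm_neg]
    congr 1
    simp [Matrix.det_fin_two, hA']
  have hgap : gap A' = gap A := by rw [gap, gap, hc0, hc1, hd, add_comm]
  have heig : eig A' = eig A := by rw [eig, eig, hc0, hc1, hgap, add_comm (colSq A 1)]
  have hw : ∀ k, weight A' k 1 = weight A k 0 := fun k => by
    rw [weight_one]
    simp [weight, hc, heig, hgap]
  have hov : 0 < Real.sqrt (weight A 0 0) * Real.sqrt (weight B 0 i) +
      Real.sqrt (weight A 1 0) * Real.sqrt (weight B 1 i) := by
    have h1 := fun k => Real.sqrt_pos.2 (weight_pos hA k 0)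
    have h2 := fun k => Real.sqrt_pos.2 (weight_pos hB k i)
    exact add_pos (mul_pos (h1 0) (h2 0)) (mul_pos (h1 1) (h2 1))
  rw [gain, gain, hw, hw, heig]
  have := eig_one_lt_eig_zero hA
  have := eig_pos hB' i
  gcongr

/-! ### Measurability -/

section Measurability

variable {α : Type*} [MeasurableSpace α] {M N : α → Matrix (Fin 2) (Fin 2) ℂ}

lemma measurable_colSq (hM : ∀ r c, Measurable fun x => M x r c) (k : Fin 2) :
    Measurable fun x => colSq (M x) k := by
  unfold colSq
  exact ((hM 0 k).norm.pow_const 2).add ((hM 1 k).norm.pow_const 2)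

lemma measurable_gap (hM : ∀ r c, Measurable fun x => M x r c) :
    Measurable fun x => gap (M x) := by
  have h0 := measurable_colSq hM 0
  have h1 := measurable_colSq hM 1
  have hd : Measurable fun x => (M x).det := by
    simp only [Matrix.det_fin_two]
    exact ((hM 0 0).mul (hM 1 1)).sub ((hM 0 1).mul (hM 1 0))
  unfold gap
  fun_prop

lemma measurable_eig (hM : ∀ r c, Measurable fun x => M x r c) (j : Fin 2) :
    Measurable fun x => eig (M x) j := by
  have h0 := measurable_colSq hM 0
  have h1 := measurable_colSq hM 1
  have hg := measurable_gap hM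
  fin_cases j <;> simp [eig] <;> fun_prop

lemma measurable_weight (hM : ∀ r c, Measurable fun x => M x r c) (k j : Fin 2) :
    Measurable fun x => weight (M x) k j := by
  have h0 := measurable_eig hM 0
  have h1 := measurable_eig hM 1
  have hc := measurable_colSq hM k
  have hg := measurable_gap hM
  fin_cases j <;> simp [weight] <;> fun_prop

lemma measurable_gain (hM : ∀ r c, Measurable fun x => M x r c)
    (hN : ∀ r c, Measurable fun x => N x r c) (j i : Fin 2) :
    Measurable fun x => gain (M x) (N x) j i := by
  have h1 := measurable_eig hM j
  have h2 := measurable_eig hN i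
  have h3 := fun k => measurable_weight hM k j
  have h4 := fun k => measurable_weight hN k i
  exact (h1.mul h2).mul ((((h3 0).sqrt.mul (h4 0).sqrt).add
    ((h3 1).sqrt.mul (h4 1).sqrt)).pow_const 2)

end Measurability

/-! ### The standard complex Gaussian law -/

lemma measurable_complexMk : Measurable fun p : ℝ × ℝ => (⟨p.1, p.2⟩ : ℂ) :=
  Complex.measurableEquivRealProd.symm.measurable

instance : IsProbabilityMeasure stdComplexGaussian :=
  Measure.isProbabilityMeasure_map measurable_complexMk.aemeasurable

lemma stdComplexGaussian_ae_ne (a : ℂ) : ∀ᵐ z ∂stdComplexGaussian, z ≠ a := by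
  have : NullSingletonClass (gaussianReal 0 (1 / 2)) :=
    nullSingletonClass_gaussianReal (by norm_num)
  refine (ae_map_iff measurable_complexMk.aemeasurable (measurableSet_singleton a).compl).2 ?_
  filter_upwards [Measure.ae_ne ((gaussianReal 0 (1 / 2)).prod (gaussianReal 0 (1 / 2)))
    (a.re, a.im)] with p hp h
  exact hp (Prod.ext (congrArg Complex.re h) (congrArg Complex.im h))

lemma integrable_norm_sq_stdComplexGaussian :
    Integrable (fun z : ℂ => ‖z‖ ^ 2) stdComplexGaussian := by
  have h : Integrable (fun x : ℝ => x ^ 2) (gaussianReal 0 (1 / 2)) :=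
    (memLp_id_gaussianReal 2).integrable_sq
  rw [stdComplexGaussian, integrable_map_measure (by fun_prop) measurable_complexMk.aemeasurable]
  refine ((h.comp_fst _).add (h.comp_snd _)).congr (ae_of_all _ fun p => ?_)
  simp only [Pi.add_apply, Function.comp_apply]
  rw [← Complex.normSq_eq_norm_sq, Complex.normSq_apply]
  ring

/-! ### The joint law of the channel coefficients -/

/-- The index set of the eight channel coefficients: entries of `G` on the left, entries of `H` on
the right. -/
abbrev Entry : Type := (Fin 2 × Fin 2) ⊕ (Fin 2 × Fin 2)

/-- The joint law of the eight channel coefficients. -/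
noncomputable def channelLaw : Measure (Entry → ℂ) := Measure.pi fun _ => stdComplexGaussian

instance : IsProbabilityMeasure channelLaw := by unfold channelLaw; infer_instance

/-- The matrix `G` read off from the eight channel coefficients. -/
def matG (z : Entry → ℂ) : Matrix (Fin 2) (Fin 2) ℂ := Matrix.of fun r c => z (Sum.inl (r, c))

/-- The matrix `Hᵀ` read off from the eight channel coefficients. -/
def matHT (z : Entry → ℂ) : Matrix (Fin 2) (Fin 2) ℂ := Matrix.of fun r c => z (Sum.inr (c, r))

lemma measurable_matG (r c : Fin 2) : Measurable fun z => matG z r c :=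
  measurable_pi_apply (Sum.inl (r, c))

lemma measurable_matHT (r c : Fin 2) : Measurable fun z => matHT z r c :=
  measurable_pi_apply (Sum.inr (c, r))

lemma measurePreserving_comp_perm (e : Equiv.Perm Entry) :
    MeasurePreserving (fun z : Entry → ℂ => z ∘ e) channelLaw channelLaw := by
  have h := measurePreserving_piCongrLeft (α := fun _ : Entry => ℂ)
    (fun _ => stdComplexGaussian) e.symm
  unfold channelLaw
  convert h using 1
  ext z k
  have := MeasurableEquiv.piCongrLeft_apply_apply (β := fun _ : Entry => ℂ) e.symm z (e k)
  simpa using this.symm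

/-- The permutation of the channel coefficients that exchanges the entries of `G` and of `Hᵀ`. -/
def swapGH : Equiv.Perm Entry :=
  (Equiv.sumComm _ _).trans (Equiv.sumCongr (Equiv.prodComm _ _) (Equiv.prodComm _ _))

/-- The permutation of the channel coefficients that exchanges the columns of `G`. -/
def swapCols : Equiv.Perm Entry :=
  Equiv.sumCongr (Equiv.prodCongr (Equiv.refl _) Fin.revPerm) (Equiv.refl _)

lemma matG_swapGH (z : Entry → ℂ) : matG (z ∘ swapGH) = matHT z := rfl

lemma matHT_swapGH (z : Entry → ℂ) : matHT (z ∘ swapGH) = matG z := rfl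

lemma matG_swapCols (z : Entry → ℂ) (r c : Fin 2) :
    matG (z ∘ swapCols) r c = matG z r (Fin.rev c) := rfl

lemma matHT_swapCols (z : Entry → ℂ) : matHT (z ∘ swapCols) = matHT z := rfl

/-- Almost surely a channel coefficient avoids any value computed from the other coefficients. -/
lemma channelLaw_ae_ne (e : Entry) {g : (Entry → ℂ) → ℂ} (hg : Measurable g)
    (hge : ∀ z w, g (Function.update z e w) = g z) : ∀ᵐ z ∂channelLaw, z e ≠ g z := by
  have hind : iIndepFun (fun (i : Entry) (z : Entry → ℂ) => z i) channelLaw :=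
    iIndepFun_pi (X := fun _ => id) fun _ => aemeasurable_id
  have hindep := hind.indepFun_finset {e}ᶜ {e} (disjoint_compl_left) fun i => measurable_pi_apply i
  -- `g` as a function of the other coefficients, with `0` put at the place `e`
  let ext : ((({e}ᶜ : Finset Entry) → ℂ) → Entry → ℂ) :=
    fun t i => if h : i ∈ ({e}ᶜ : Finset Entry) then t ⟨i, h⟩ else 0
  have hext : Measurable ext := by
    refine measurable_pi_lambda _ fun i => ?_
    by_cases h : i ∈ ({e}ᶜ : Finset Entry)
    · simp only [ext, dif_pos h]
      exact measurable_pi_apply _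
    · simp only [ext, dif_neg h]
      exact measurable_const
  have hindep' : IndepFun g (fun z : Entry → ℂ => z e) channelLaw := by
    have := hindep.comp (hg.comp hext)
      (measurable_pi_apply (⟨e, Finset.mem_singleton_self e⟩ : ({e} : Finset Entry)))
    convert this using 1
    swap
    · rfl
    funext z
    simp only [Function.comp_apply]
    rw [← hge z 0]
    congr 1
    funext i
    by_cases h : i = e
    · subst h
      simp [ext]
    · simp [ext, h]
  have hmap := hindep'.map_prod_eq_prod_map_map hg.aemeasurable
    (measurable_pi_apply e).aemeasurable
  have hlaw : channelLaw.map (fun z => z e) = stdComplexGaussian :=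
    (measurePreserving_eval (fun _ => stdComplexGaussian) e).map_eq
  rw [hlaw] at hmap
  have hmeas : MeasurableSet {p : ℂ × ℂ | p.2 ≠ p.1} :=
    (measurableSet_eq_fun measurable_snd measurable_fst).compl
  have hae : ∀ᵐ p ∂channelLaw.map (fun z => (g z, z e)), p.2 ≠ p.1 := by
    rw [hmap]
    exact (Measure.ae_prod_iff_ae_ae hmeas).2 (ae_of_all _ stdComplexGaussian_ae_ne)
  exact (ae_map_iff (hg.prodMk (measurable_pi_apply e)).aemeasurable hmeas).1 hae

lemma crossTerm_matG_ne_zero : ∀ᵐ z ∂channelLaw, crossTerm (matG z) ≠ 0 := by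
  filter_upwards [channelLaw_ae_ne (Sum.inl (0, 0)) (g := fun _ => 0) measurable_const (by simp),
    channelLaw_ae_ne (Sum.inl (0, 1))
      (g := fun z => -(star (z (Sum.inl (1, 0))) * z (Sum.inl (1, 1))) / star (z (Sum.inl (0, 0))))
      (by fun_prop) (by simp)] with z h0 h1 h
  refine h1 ((eq_div_iff (star_ne_zero.2 h0)).2 ?_)
  simp only [crossTerm, matG, Matrix.of_apply] at h
  linear_combination h

lemma det_matG_ne_zero : ∀ᵐ z ∂channelLaw, (matG z).det ≠ 0 := by
  filter_upwards [channelLaw_ae_ne (Sum.inl (0, 0)) (g := fun _ => 0) measurable_const (by simp),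
    channelLaw_ae_ne (Sum.inl (1, 1))
      (g := fun z => z (Sum.inl (0, 1)) * z (Sum.inl (1, 0)) / z (Sum.inl (0, 0)))
      (by fun_prop) (by simp)] with z h0 h1 h
  refine h1 ((eq_div_iff h0).2 ?_)
  simp only [matG, Matrix.det_fin_two, Matrix.of_apply] at h
  linear_combination h

lemma crossTerm_matHT_ne_zero : ∀ᵐ z ∂channelLaw, crossTerm (matHT z) ≠ 0 :=
  (measurePreserving_comp_perm swapGH).quasiMeasurePreserving.ae crossTerm_matG_ne_zero

lemma det_matHT_ne_zero : ∀ᵐ z ∂channelLaw, (matHT z).det ≠ 0 :=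
  (measurePreserving_comp_perm swapGH).quasiMeasurePreserving.ae det_matG_ne_zero

/-! ### Integrability and comparison of the expected gains -/

lemma integrable_norm_sq_mul_norm_sq {e f : Entry} (hef : e ≠ f) :
    Integrable (fun z : Entry → ℂ => ‖z e‖ ^ 2 * ‖z f‖ ^ 2) channelLaw := by
  have hind : iIndepFun (fun (i : Entry) (z : Entry → ℂ) => ‖z i‖ ^ 2) channelLaw :=
    iIndepFun_pi (X := fun _ (w : ℂ) => ‖w‖ ^ 2) fun _ => by fun_prop
  have hint : ∀ e : Entry, Integrable (fun z : Entry → ℂ => ‖z e‖ ^ 2) channelLaw := fun e =>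
    (measurePreserving_eval (fun _ => stdComplexGaussian) e).integrable_comp_of_integrable
      integrable_norm_sq_stdComplexGaussian
  exact (hind.indepFun hef).integrable_mul (hint e) (hint f)

lemma integrable_gain (j i : Fin 2) :
    Integrable (fun z => gain (matG z) (matHT z) j i) channelLaw := by
  have hcc : ∀ k l, Integrable (fun z => colSq (matG z) k * colSq (matHT z) l) channelLaw := by
    intro k l
    have h := fun r s => integrable_norm_sq_mul_norm_sq
      (e := Sum.inl (r, k)) (f := Sum.inr (l, s)) (by simp)
    refine (((h 0 0).add (h 0 1)).add ((h 1 0).add (h 1 1))).congr (ae_of_all _ fun z => ?_)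
    simp only [colSq, matG, matHT, Matrix.of_apply, Pi.add_apply]
    ring
  refine ((((hcc 0 0).add (hcc 0 1)).add ((hcc 1 0).add (hcc 1 1))).mul_const (2 ^ 2)).mono'
    (measurable_gain measurable_matG measurable_matHT j i).aestronglyMeasurable
    (ae_of_all _ fun z => ?_)
  rw [Real.norm_of_nonneg (gain_nonneg _ _ _ _)]
  refine (gain_le _ _ _ _).trans_eq ?_
  simp only [Pi.add_apply]
  ring

lemma integral_gain_comm (j i : Fin 2) :
    ∫ z, gain (matG z) (matHT z) j i ∂channelLaw =
      ∫ z, gain (matG z) (matHT z) i j ∂channelLaw := by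
  have h := (measurePreserving_comp_perm swapGH).hasLaw.integral_comp
    (measurable_gain measurable_matG measurable_matHT i j).aestronglyMeasurable
  rw [← h]
  simp only [Function.comp_apply, matG_swapGH, matHT_swapGH]
  exact integral_congr_ae (ae_of_all _ fun z => gain_comm _ _ _ _)

/-- Passing to the weaker singular direction of `G` decreases the expected gain: exchanging the
columns of `G` does not change the law, and after this change of variables the two integrands are
comparable pointwise. -/
lemma integral_gain_one_lt (i : Fin 2) :
    ∫ z, gain (matG z) (matHT z) 1 i ∂channelLaw <
      ∫ z, gain (matG z) (matHT z) 0 i ∂channelLaw := by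
  have hmp := measurePreserving_comp_perm swapCols
  have h : ∫ z, gain (matG (z ∘ swapCols)) (matHT (z ∘ swapCols)) 1 i ∂channelLaw =
      ∫ z, gain (matG z) (matHT z) 1 i ∂channelLaw := hmp.hasLaw.integral_comp
    (measurable_gain measurable_matG measurable_matHT 1 i).aestronglyMeasurable
  have hint : Integrable (fun z => gain (matG (z ∘ swapCols)) (matHT (z ∘ swapCols)) 1 i)
      channelLaw := hmp.integrable_comp_of_integrable (integrable_gain 1 i)
  have hlt : ∀ᵐ z ∂channelLaw, gain (matG (z ∘ swapCols)) (matHT (z ∘ swapCols)) 1 i <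
      gain (matG z) (matHT z) 0 i := by
    filter_upwards [crossTerm_matG_ne_zero, crossTerm_matHT_ne_zero, det_matHT_ne_zero]
      with z h1 h2 h3
    rw [matHT_swapCols]
    exact gain_one_swap_lt (matG_swapCols z) h1 h2 h3 i
  rw [← h, ← sub_pos, ← integral_sub (integrable_gain 0 i) hint,
    integral_pos_iff_support_of_nonneg_ae (hlt.mono fun z hz => (sub_pos.2 hz).le)
      ((integrable_gain 0 i).sub hint)]
  have : Function.support (fun z => gain (matG z) (matHT z) 0 i -
      gain (matG (z ∘ swapCols)) (matHT (z ∘ swapCols)) 1 i) =ᵐ[channelLaw] Set.univ :=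
    Filter.eventuallyEq_univ.2 (hlt.mono fun z hz => (sub_pos.2 hz).ne')
  exact (measure_congr this).symm ▸ (by simp)

lemma hasLaw_channelLaw {Ω : Type*} [MeasurableSpace Ω] {P : Measure Ω} [IsProbabilityMeasure P]
    {G H : Ω → Matrix (Fin 2) (Fin 2) ℂ} (h : IsRayleighFading P G H) :
    HasLaw (fun x => (Sum.elim (fun rc : Fin 2 × Fin 2 => G x rc.1 rc.2)
      (fun rc : Fin 2 × Fin 2 => H x rc.1 rc.2) : Entry → ℂ)) channelLaw P := by
  set X : Entry → Ω → ℂ := Sum.elim (fun (rc : Fin 2 × Fin 2) (x : Ω) => G x rc.1 rc.2)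
      (fun (rc : Fin 2 × Fin 2) (x : Ω) => H x rc.1 rc.2) with hX
  have hlaw : ∀ e, HasLaw (X e) stdComplexGaussian P := by
    rintro (⟨r, c⟩ | ⟨r, c⟩)
    exacts [h.law_G r c, h.law_H r c]
  have heq : (fun x => (Sum.elim (fun rc : Fin 2 × Fin 2 => G x rc.1 rc.2)
      (fun rc : Fin 2 × Fin 2 => H x rc.1 rc.2) : Entry → ℂ)) = fun x e => X e x := by
    funext x e
    cases e <;> rfl
  rw [heq]
  refine ⟨aemeasurable_pi_lambda _ fun e => (hlaw e).aemeasurable, ?_⟩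
  rw [(iIndepFun_iff_map_fun_eq_pi_map fun e => (hlaw e).aemeasurable).1 h.indep]
  simp only [(hlaw _).map_eq, channelLaw]

end RISChannel

open RISChannel in
theorem corollary1 {Ω : Type*} [MeasurableSpace Ω] (P : Measure Ω) [IsProbabilityMeasure P]
    (ρ σ : ℝ) (hρ : 0 < ρ) (hσ : 0 < σ)
    (G H : Ω → Matrix (Fin 2) (Fin 2) ℂ) (hGH : IsRayleighFading P G H)
    (U V W Q : Ω → Matrix (Fin 2) (Fin 2) ℂ) (lam om : Ω → Fin 2 → ℝ)
    (hG : ∀ᵐ x ∂P, IsSVD (G x) (U x) (lam x) (V x))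
    (hH : ∀ᵐ x ∂P, IsSVD (H x) (W x) (om x) (Q x)) :
    (∀ j i : Fin 2, ∀ᵐ x ∂P,
      snrCmp ρ σ (G x) (H x) (U x) (V x) (W x) (Q x) j i =
        ρ / σ ^ 2 * lam x j * om x i *
          (‖V x 0 j‖ * ‖W x 0 i‖ + ‖V x 1 j‖ * ‖W x 1 i‖) ^ 2) ∧
    (∀ j i : Fin 2,
      Integrable (fun x => snrCmp ρ σ (G x) (H x) (U x) (V x) (W x) (Q x) j i) P) ∧
    (∫ x, snrCmp ρ σ (G x) (H x) (U x) (V x) (W x) (Q x) 0 0 ∂P) >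
      (∫ x, snrCmp ρ σ (G x) (H x) (U x) (V x) (W x) (Q x) 1 0 ∂P) ∧
    (∫ x, snrCmp ρ σ (G x) (H x) (U x) (V x) (W x) (Q x) 1 0 ∂P) =
      (∫ x, snrCmp ρ σ (G x) (H x) (U x) (V x) (W x) (Q x) 0 1 ∂P) ∧
    (∫ x, snrCmp ρ σ (G x) (H x) (U x) (V x) (W x) (Q x) 0 1 ∂P) >
      (∫ x, snrCmp ρ σ (G x) (H x) (U x) (V x) (W x) (Q x) 1 1 ∂P) := by
  set Z : Ω → Entry → ℂ := fun x => Sum.elim (fun rc : Fin 2 × Fin 2 => G x rc.1 rc.2)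
    (fun rc : Fin 2 × Fin 2 => H x rc.1 rc.2) with hZ
  have hlaw : HasLaw Z channelLaw P := hasLaw_channelLaw hGH
  have hne : ∀ᵐ z ∂P.map Z, crossTerm (matG z) ≠ 0 ∧ crossTerm (matHT z) ≠ 0 := by
    rw [hlaw.map_eq]
    exact crossTerm_matG_ne_zero.and crossTerm_matHT_ne_zero
  have hsnr : ∀ j i, (fun x => snrCmp ρ σ (G x) (H x) (U x) (V x) (W x) (Q x) j i) =ᵐ[P]
      fun x => ρ / σ ^ 2 * gain (matG (Z x)) (matHT (Z x)) j i := by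
    intro j i
    filter_upwards [hG, hH, ae_of_ae_map hlaw.aemeasurable hne] with x hGx hHx hx
    exact snrCmp_eq_gain ρ σ hGx hHx hx.1 hx.2 j i
  have hgain : ∀ j i, Integrable (fun x => gain (matG (Z x)) (matHT (Z x)) j i) P := by
    intro j i
    have h := integrable_gain j i
    rw [← hlaw.map_eq] at h
    exact h.comp_aemeasurable hlaw.aemeasurable
  have hexp : ∀ j i, ∫ x, snrCmp ρ σ (G x) (H x) (U x) (V x) (W x) (Q x) j i ∂P =
      ρ / σ ^ 2 * ∫ z, gain (matG z) (matHT z) j i ∂channelLaw := by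
    intro j i
    rw [integral_congr_ae (hsnr j i), integral_const_mul]
    congr 1
    exact hlaw.integral_comp
      (measurable_gain measurable_matG measurable_matHT j i).aestronglyMeasurable
  have hpos : 0 < ρ / σ ^ 2 := by positivity
  refine ⟨fun j i => ?_, fun j i => ((hgain j i).const_mul _).congr (hsnr j i).symm, ?_, ?_, ?_⟩
  · filter_upwards [hG, hH] with x hGx hHx
    exact snrCmp_eq ρ σ hGx hHx j i
  · rw [hexp, hexp]
    exact mul_lt_mul_of_pos_left (integral_gain_one_lt 0) hpos
  · rw [hexp, hexp, integral_gain_comm]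
  · rw [hexp, hexp]
    exact mul_lt_mul_of_pos_left (integral_gain_one_lt 1) hpos
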